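/- **Setting.** Fix a signed cancellation meadow $\mathfrak M$: a commutative ring with a unary operation ${}^{-1}$ such that $(x^{-1})^{-1}=x$ and $x(xx^{-1})=x$, satisfying $x\neq 0\wedge xy=xz\Rightarrow y=z$, with a signum operation $s$ such that (writing $x/y=xy^{-1}$) $s(x/x)=x/x$, $s(1-x/x)=1-x/x$, $s(-1)=-1$, $s(x^{-1})=s(x)$, $s(xy)=s(x)s(y)$, $\bigl(1-\frac{s(x)-s(y)}{s(x)-s(y)}\bigr)(s(x+y)-s(x))=0$. Put $\mathcal P=\{\pi\in\mathfrak M: s(s(\pi)+1)\,s(s(1-\pi)+1)=1\}$ (the probabilities, i.e. $0\le\pi\le1$). Fix a set $A$ of actions, $\delta\notin A$, $A_\delta=A\cup\{\delta\}$, a commutative associative $\gamma:A_\delta\times A_\delta\to A_\delta$ with $\gamma(\delta,a)=\delta$, and a countably infinite set $\mathcal X$ of variables. **pACP.** Terms are built from variables, constants $a\in A_\delta$, binary operators $+$, $\cdot$, $\oplus_\pi$ ($\pi\in\mathcal P$), $\parallel$, $\lfloor$ (left merge), $|$ (communication merge), and unary operators $\partial_H$ ($H\subseteq A$). The axioms are,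 for $a,b\in A_\delta$, $\pi,\rho\in\mathcal P$, $H\subseteq A$: - $x+y=y+x$; $(x+y)+z=x+(y+z)$; $a+a=a$; $(x+y)z=xz+yz$; $(xy)z=x(yz)$; $x+\delta=x$; $\delta x=\delta$; - $\partial_H(a)=a$ if $a\notin H$; $\partial_H(a)=\delta$ if $a\in H$; $\partial_H(x+y)=\partial_H(x)+\partial_H(y)$; $\partial_H(xy)=\partial_H(x)\partial_H(y)$; $\partial_H(x\oplus_\pi y)=\partial_H(x)\oplus_\pi\partial_H(y)$; - $x\oplus_\pi y=y\oplus_{1-\pi}x$; $(x\oplus_\pi y)\oplus_\rho z=x\oplus_{\pi\rho}(y\oplus_{(1-\pi)\rho/(1-\pi\rho)}z)$; $x\oplus_\pi x=x$; $(x\oplus_\pi y)z=xz\oplus_\pi yz$; $(x\oplus_\pi y)+z=(x+z)\oplus_\pi(y+z)$; $x\oplus_1y=x$; - $x=x+x\wedge y=y+y\Rightarrow x\parallel y=x\lfloor y+y\lfloor x+x|y$; $a\lfloor x=ax$; $ax\lfloor y=a(x\parallel y)$; $(x+y)\lfloor z=x\lfloor z+y\lfloor z$; - $ax|b=\gamma(a,b)x$;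 $a|bx=\gamma(a,b)x$; $ax|by=\gamma(a,b)(x\parallel y)$; $(x+y)|z=x|z+y|z$; $x|(y+z)=x|y+x|z$; $\delta|x=\delta$; $x|\delta=\delta$; $a|b=\gamma(a,b)$; - for each $\diamond\in\{\parallel,\lfloor,|\}$: $(x\oplus_\pi y)\diamond z=(x\diamond z)\oplus_\pi(y\diamond z)$ and $x\diamond(y\oplus_\pi z)=(x\diamond y)\oplus_\pi(x\diamond z)$. **pACP+pSI.** For $n\ge1$ the sets $\mathcal H_n$ of interleaving histories (finite sequences of pairs of positive integers) are inductively defined by: the empty sequence is in every $\mathcal H_n$; if $h\in\mathcal H_n$, $1\le j\le n$, $m\ge1$ and $n-1\le m\le n+1$, then $h(j,m)\in\mathcal H_m$ (the sequence $h$ followed by the pair $(j,m)$). Fix a set $S$ and, for all $n\ge1$, a partial function $\sigma_n:\mathcal H_n\times S\rightharpoonup(\{1,\dots,n\}\to\mathcal P)$ with $\sum_i\sigma_n(h,s)(i)=1$ whenever $\sigma_n(h,s)$ is defined, and a function $\theta_n:\mathcal H_n\times S\times\{1,\dots,n\}\times A\times\{0,1\}\to S$; a set $C\subseteq A$ with $\theta_n(h,s,i,a,0)=s$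 for $a\notin C$, and for each $c\in C$ an action $\bar c\in A\setminus C$ such that, for all $a,b\in A$, $\gamma(a,b)\ne c$, $\gamma(a,b)\ne\bar c$, $\gamma(a,c)=\gamma(a,\bar c)=\delta$; a set $D$, functions $\mathrm{cr},\overline{\mathrm{cr}}:D\to A$ with $\gamma(\mathrm{cr}(d),a)=\delta$ and $\gamma(a,b)\neq\mathrm{cr}(d)$ for all $a,b\in A$, and a function $\phi$ from $D$ to the closed pACP+pSI terms. Terms of pACP+pSI have in addition, for $n\ge1$, $h\in\mathcal H_n$, $s\in S$ and $1\le i\le n$, the $n$-ary operators $\Vert^n_{h,s}$ (strategic interleaving) and $\Vert^{n,i}_{h,s}$ (positional strategic interleaving). Write $\vec x=(x_1,\dots,x_n)$, $\vec x[i:=t]$ for $\vec x$ with $i$-th entry replaced by $t$, $\vec x\setminus i$ for $\vec x$ with $i$-th entry removed, and $\vec x,t$ for $\vec x$ with $t$ appended. The axioms are those of pACP and, for $a\in A$ not of the form $\mathrm{cr}(d)$ and $d\in D$: - $\bigwedge_{i\le n}x_i=x_i+x_i\Rightarrow\Vert^n_{h,s}(\vec x)=\delta$ if $\sigma_n(h,s)$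 is undefined; - $\bigwedge_{i\le n}x_i=x_i+x_i\Rightarrow\Vert^n_{h,s}(\vec x)=\bigoplus_{i=1}^n\sigma_n(h,s)(i):\Vert^{n,i}_{h,s}(\vec x)$ if $\sigma_n(h,s)$ is defined, where $\bigoplus_{i=1}^1\pi_i:t_i=t_1$ and $\bigoplus_{i=1}^{n+1}\pi_i:t_i=t_1\oplus_{\pi_1}\bigl(\bigoplus_{i=1}^n\frac{\pi_{i+1}}{1-\pi_1}:t_{i+1}\bigr)$; - $\Vert^{n,i}_{h,s}(\vec x[i:=\delta])=\delta$; $\Vert^{1,1}_{h,s}(a)=a$; - $\Vert^{n+1,i}_{h,s}(\vec x[i:=a])=a\cdot\Vert^n_{h(i,n),\,\theta_{n+1}(h,s,i,a,1)}(\vec x\setminus i)$; - $\Vert^{n,i}_{h,s}(\vec x[i:=a y])=a\cdot\Vert^n_{h(i,n),\,\theta_n(h,s,i,a,0)}(\vec x[i:=y])$; - $\Vert^{n,i}_{h,s}(\vec x[i:=\mathrm{cr}(d)])=\overline{\mathrm{cr}}(d)\cdot\Vert^n_{h(i,n),\,\theta_n(h,s,i,\mathrm{cr}(d),1)}(\vec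 x\setminus i,\phi(d))$; - $\Vert^{n,i}_{h,s}(\vec x[i:=\mathrm{cr}(d)\,y])=\overline{\mathrm{cr}}(d)\cdot\Vert^{n+1}_{h(i,n+1),\,\theta_n(h,s,i,\mathrm{cr}(d),0)}(\vec x[i:=y],\phi(d))$; - $\Vert^{n,i}_{h,s}(\vec x[i:=y+z])=\Vert^{n,i}_{h,s}(\vec x[i:=y])+\Vert^{n,i}_{h,s}(\vec x[i:=z])$; and $F(\vec x[i:=y\oplus_\pi z])=F(\vec x[i:=y])\oplus_\pi F(\vec x[i:=z])$ for $F=\Vert^n_{h,s}$ and for $F=\Vert^{n,i}_{h,s}$. **Guarded recursion.** Let $\mathrm{PPA}$ be pACP or pACP+pSI. A PPA term is guarded if every occurrence of a variable in it lies within the $t$ of some subterm $a\cdot t$ with $a\in A$. A recursive specification $E$ over PPA is a (finite or countably infinite) set of equations $X=t_X$, one for each $X$ in a set $\mathrm{vars}(E)\subseteq\mathcal X$, with $t_X$ a PPA term containing only variables from $\mathrm{vars}(E)$; it is guarded if each $t_X$ can be rewritten to a guarded PPA term using the axioms of PPA in either direction and the equations $Y=t_Y$ of $E$ with $Y\ne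 X$ from left to right. The theory $\mathrm{PPA}_{\rm rec}$ has in addition a constant $\langle X|E\rangle$ for each guarded recursive specification $E$ over PPA and $X\in\mathrm{vars}(E)$, and the axioms $\langle X|E\rangle=\langle t_X|E\rangle$ (RDP; $\langle t|E\rangle$ is $t$ with each $Y\in\mathrm{vars}(E)$ replaced by $\langle Y|E\rangle$) and $E\Rightarrow X=\langle X|E\rangle$ (RSP). Derivability is derivability in infinitary conditional equational logic. **Theorem (Expressivity).** For each guarded recursive specification $E$ over pACP+pSI and each $X\in\mathrm{vars}(E)$, there exists a guarded recursive specification $E'$ over pACP, with $X\in\mathrm{vars}(E')$, such that $\langle X|E\rangle=\langle X|E'\rangle$ is derivable from the axioms of $(\text{pACP+pSI})_{\rm rec}$. (Here pACP and pACP+pSI have the same $\mathfrak M$, $A$ and $\gamma$, and $E'$ is regarded as a guarded recursive specification over pACP+pSI.) -/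

import Mathlib

/-! ### Signed cancellation meadows and probabilities -/

/-- A signed cancellation meadow: a commutative ring with a total inverse and a signum operation
satisfying the meadow axioms, the cancellation axiom and the signum axioms (`x / y` is written
`x * y⁻¹`). The one-element meadow is not excluded. -/
class SignedCancellationMeadow (M : Type*) extends CommRing M, Inv M where
  inv_inv : ∀ x : M, (x⁻¹)⁻¹ = x
  mul_mul_inv : ∀ x : M, x * (x * x⁻¹) = x
  cancel : ∀ x y z : M, x ≠ 0 → x * y = x * z → y = z
  sign : M → M
  sign_div_self : ∀ x : M, sign (x * x⁻¹) = x * x⁻¹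
  sign_one_sub_div_self : ∀ x : M, sign (1 - x * x⁻¹) = 1 - x * x⁻¹
  sign_neg_one : sign (-1) = -1
  sign_inv : ∀ x : M, sign x⁻¹ = sign x
  sign_mul : ∀ x y : M, sign (x * y) = sign x * sign y
  sign_add : ∀ x y : M,
    (1 - (sign x - sign y) * (sign x - sign y)⁻¹) * (sign (x + y) - sign x) = 0

namespace SignedCancellationMeadow

variable {M : Type*} [SignedCancellationMeadow M]

/-- `π` is a probability, i.e. `0 ≤ π ≤ 1` in terms of the signum operation. -/
def IsProb (π : M) : Prop :=
  sign (sign π + 1) * sign (sign (1 - π) + 1) = 1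

/-- Auxiliary: `0 ≤ x`. -/
def Nonneg (x : M) : Prop := x = 0 ∨ sign x = 1

theorem inv_zero' : (0 : M)⁻¹ = 0 := by
  have h := mul_mul_inv ((0 : M)⁻¹)
  rw [inv_inv] at h
  rw [← h]; ring

theorem sign_zero' : sign (0 : M) = 0 := by
  have h := sign_div_self (0 : M)
  simpa using h

theorem sign_one' : sign (1 : M) = 1 := by
  have h := sign_one_sub_div_self (0 : M)
  simpa using h

theorem mul_inv' {x : M} (hx : x ≠ 0) : x * x⁻¹ = 1 :=
  cancel x _ _ hx (by rw [mul_mul_inv, mul_one])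

theorem eq_zero_or {x y : M} (h : x * y = 0) : x = 0 ∨ y = 0 := by
  by_cases hx : x = 0
  · exact Or.inl hx
  · exact Or.inr (cancel x y 0 hx (by rw [h, mul_zero]))

theorem sign_sq {x : M} (hx : x ≠ 0) : sign x * sign x = 1 := by
  have h := sign_mul x x⁻¹
  rw [mul_inv' hx, sign_one', sign_inv] at h
  exact h.symm

theorem sign_cases {x : M} (hx : x ≠ 0) : sign x = 1 ∨ sign x = -1 := by
  have h : (sign x - 1) * (sign x + 1) = 0 := by
    have := sign_sq hx
    linear_combination this
  rcases eq_zero_or h with h | h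
  · exact Or.inl (sub_eq_zero.mp h)
  · exact Or.inr (eq_neg_of_add_eq_zero_left h)

theorem sign_add_of_eq {x y : M} (h : sign x = sign y) : sign (x + y) = sign x := by
  have h' := sign_add x y
  rw [h, sub_self, zero_mul, sub_zero, one_mul] at h'
  rw [h]; exact sub_eq_zero.mp h'

theorem sign_two : sign ((1 : M) + 1) = 1 := by
  rw [sign_add_of_eq rfl, sign_one']

theorem sign_sign_add_one {x : M} :
    (Nonneg x ∧ sign (sign x + 1) = 1) ∨ (sign x = -1 ∧ sign (sign x + 1) = 0) := by
  by_cases hx : x = 0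
  · left; exact ⟨Or.inl hx, by rw [hx, sign_zero', zero_add, sign_one']⟩
  · rcases sign_cases hx with h | h
    · left; exact ⟨Or.inr h, by rw [h, sign_two]⟩
    · right; exact ⟨h, by rw [h, neg_add_cancel, sign_zero']⟩

theorem isProb_of_subsingleton (h : (1 : M) = 0) (x : M) : IsProb x := by
  have : ∀ y z : M, y = z := fun y z => by
    rw [← mul_one y, ← mul_one z, h, mul_zero, mul_zero]
  exact this _ _

theorem isProb_iff {π : M} : IsProb π ↔ Nonneg π ∧ Nonneg (1 - π) := by
  by_cases h10 : (1 : M) = 0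
  · have : ∀ y : M, y = 0 := fun y => by rw [← mul_one y, h10, mul_zero]
    exact ⟨fun _ => ⟨Or.inl (this _), Or.inl (this _)⟩, fun _ => isProb_of_subsingleton h10 _⟩
  · have key : ∀ x : M, Nonneg x → sign (sign x + 1) = 1 := by
      rintro x (h | h)
      · rw [h, sign_zero', zero_add, sign_one']
      · rw [h, sign_two]
    constructor
    · intro h
      unfold IsProb at h
      rcases sign_sign_add_one (x := π) with ⟨h1, -⟩ | ⟨-, h1⟩
      · rcases sign_sign_add_one (x := 1 - π) with ⟨h2, -⟩ | ⟨-, h2⟩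
        · exact ⟨h1, h2⟩
        · rw [h2, mul_zero] at h; exact absurd h.symm h10
      · rw [h1, zero_mul] at h; exact absurd h.symm h10
    · rintro ⟨h1, h2⟩
      unfold IsProb
      rw [key _ h1, key _ h2, one_mul]

theorem Nonneg.zero : Nonneg (0 : M) := Or.inl rfl

theorem Nonneg.one : Nonneg (1 : M) := Or.inr sign_one'

theorem Nonneg.add {x y : M} (hx : Nonneg x) (hy : Nonneg y) : Nonneg (x + y) := by
  rcases hx with rfl | hx
  · rwa [zero_add]
  · rcases hy with rfl | hy
    · rw [add_zero]; exact Or.inr hx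
    · exact Or.inr (by rw [sign_add_of_eq (hx.trans hy.symm), hx])

theorem Nonneg.mul {x y : M} (hx : Nonneg x) (hy : Nonneg y) : Nonneg (x * y) := by
  rcases hx with rfl | hx
  · rw [zero_mul]; exact Nonneg.zero
  · rcases hy with rfl | hy
    · rw [mul_zero]; exact Nonneg.zero
    · exact Or.inr (by rw [sign_mul, hx, hy, one_mul])

theorem Nonneg.inv {x : M} (hx : Nonneg x) : Nonneg x⁻¹ := by
  rcases hx with rfl | hx
  · rw [inv_zero']; exact Nonneg.zero
  · exact Or.inr (by rw [sign_inv, hx])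

theorem Nonneg.sum {ι : Type*} (s : Finset ι) {f : ι → M} (h : ∀ i, Nonneg (f i)) :
    Nonneg (∑ i ∈ s, f i) :=
  Finset.sum_induction f Nonneg (fun _ _ => Nonneg.add) Nonneg.zero (fun i _ => h i)

theorem isProb_one : IsProb (1 : M) :=
  isProb_iff.mpr ⟨Nonneg.one, by rw [sub_self]; exact Nonneg.zero⟩

theorem IsProb.compl {π : M} (h : IsProb π) : IsProb (1 - π) := by
  rw [isProb_iff] at *
  exact ⟨h.2, by rw [sub_sub_cancel]; exact h.1⟩

theorem IsProb.mul {π ρ : M} (h : IsProb π) (h' : IsProb ρ) : IsProb (π * ρ) := by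
  rw [isProb_iff] at *
  refine ⟨h.1.mul h'.1, ?_⟩
  have e : 1 - π * ρ = (1 - π) + π * (1 - ρ) := by ring
  rw [e]; exact h.2.add (h.1.mul h'.2)

theorem isProb_div {x y : M} (hx : Nonneg x) (hxy : Nonneg (y - x)) : IsProb (x * y⁻¹) := by
  have hy : Nonneg y := by
    have := hx.add hxy
    rwa [add_sub_cancel] at this
  rw [isProb_iff]
  refine ⟨hx.mul hy.inv, ?_⟩
  by_cases h0 : y = 0
  · rw [h0, inv_zero', mul_zero, sub_zero]; exact Nonneg.one
  · have e : 1 - x * y⁻¹ = (y - x) * y⁻¹ := by rw [sub_mul, mul_inv' h0]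
    rw [e]; exact hxy.mul hy.inv

/-- The probability used on the right-hand side of the associativity axiom pA2. -/
theorem IsProb.assoc {π ρ : M} (h : IsProb π) (h' : IsProb ρ) :
    IsProb (((1 - π) * ρ) * (1 - π * ρ)⁻¹) := by
  rw [isProb_iff] at h h'
  refine isProb_div (h.2.mul h'.1) ?_
  have e : 1 - π * ρ - (1 - π) * ρ = 1 - ρ := by ring
  rw [e]; exact h'.2

/-- Finitely many probabilities whose sum is at most one. -/
def SubProb {n : ℕ} (w : Fin n → M) : Prop := (∀ i, IsProb (w i)) ∧ IsProb (∑ i, w i)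

theorem SubProb.tail {n : ℕ} {w : Fin (n + 1) → M} (hw : SubProb w) :
    SubProb (fun i : Fin n => w i.succ * (1 - w 0)⁻¹) := by
  obtain ⟨h1, h2⟩ := hw
  have hn : ∀ i, Nonneg (w i) := fun i => (isProb_iff.mp (h1 i)).1
  rw [isProb_iff, Fin.sum_univ_succ] at h2
  have hle : Nonneg (1 - w 0 - ∑ i : Fin n, w i.succ) := by
    rw [sub_sub]; exact h2.2
  constructor
  · intro i
    refine isProb_div (hn _) ?_
    have e : 1 - w 0 - w i.succ = (1 - w 0 - ∑ j : Fin n, w j.succ) +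
        ∑ j ∈ Finset.univ.erase i, w (Fin.succ j) := by
      rw [← Finset.add_sum_erase Finset.univ (fun j : Fin n => w j.succ) (Finset.mem_univ i)]
      ring
    rw [e]; exact hle.add (Nonneg.sum _ fun j => hn _)
  · rw [← Finset.sum_mul]
    exact isProb_div (Nonneg.sum _ fun j => hn _) hle

end SignedCancellationMeadow

namespace ProcAlg

open SignedCancellationMeadow

/-- The set of probabilities of a signed cancellation meadow. -/
def Prob (M : Type*) [SignedCancellationMeadow M] : Type _ := {π : M // IsProb π}

/-! ### Terms -/

/-- The process variables: a countably infinite set. -/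
abbrev Var : Type := ℕ

/-- Binary operators: alternative composition, sequential composition, probabilistic choice,
parallel composition, left merge, communication merge. -/
inductive BinOp (M : Type*) [SignedCancellationMeadow M]
  | alt
  | seq
  | pch (π : Prob M)
  | par
  | leftm
  | commm

/-- Terms over the operators of pACP, further operators `Op n` of arity `n`, and further
constants `K`. The constants of pACP are `cst (some a)` for an action `a`, and `cst none` for
inaction. -/
inductive Term (A : Type*) (M : Type*) [SignedCancellationMeadow M] (Op : ℕ → Type*) (K : Type*)
  | var (x : Var)
  | con (k : K)
  | cst (a : Option A)
  | bin (b : BinOp M) (t u : Term A M Op K)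
  | encap (H : Set A) (t : Term A M Op K)
  | op {n : ℕ} (o : Op n) (ts : Fin n → Term A M Op K)

/-- No operators besides those of pACP. -/
abbrev NoOp : ℕ → Type := fun _ => Empty

namespace Term

section

variable {A M K : Type*} [SignedCancellationMeadow M] {Op : ℕ → Type*}

abbrev act (a : A) : Term A M Op K := cst (some a)
abbrev dead : Term A M Op K := cst none
abbrev alt (t u : Term A M Op K) : Term A M Op K := bin .alt t u
abbrev seq (t u : Term A M Op K) : Term A M Op K := bin .seq t u
abbrev pch (π : M) (h : IsProb π) (t u : Term A M Op K) : Term A M Op K :=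
  bin (.pch ⟨π, h⟩) t u
abbrev par (t u : Term A M Op K) : Term A M Op K := bin .par t u
abbrev leftm (t u : Term A M Op K) : Term A M Op K := bin .leftm t u
abbrev commm (t u : Term A M Op K) : Term A M Op K := bin .commm t u

/-- The variables occurring in a term. -/
def vars : Term A M Op K → Set Var
  | var x => {x}
  | con _ => ∅
  | cst _ => ∅
  | bin _ t u => t.vars ∪ u.vars
  | encap _ t => t.vars
  | op _ ts => ⋃ i, (ts i).vars

/-- Simultaneous substitution of terms for the variables of a term without further constants. -/
def subst (σ : Var → Term A M Op K) : Term A M Op Empty → Term A M Op K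
  | var x => σ x
  | con k => nomatch k
  | cst a => cst a
  | bin b t u => bin b (t.subst σ) (u.subst σ)
  | encap H t => encap H (t.subst σ)
  | op o ts => op o (fun i => (ts i).subst σ)

/-- A pACP term regarded as a term over a larger signature. -/
def embed : Term A M NoOp Empty → Term A M Op K
  | var x => var x
  | con k => nomatch k
  | cst a => cst a
  | bin b t u => bin b t.embed u.embed
  | encap H t => encap H t.embed
  | op o _ => nomatch o

/-- All occurrences of variables lie within some `t` of a subterm `a · t`, `a` an action. -/
inductive Guarded : Term A M Op K → Prop
  | con (k : K) : Guarded (con k)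
  | cst (a : Option A) : Guarded (cst a)
  | pre (a : A) (t : Term A M Op K) : Guarded (seq (act a) t)
  | bin (b : BinOp M) {t u : Term A M Op K} : Guarded t → Guarded u → Guarded (bin b t u)
  | encap (H : Set A) {t : Term A M Op K} : Guarded t → Guarded (encap H t)
  | op {n : ℕ} (o : Op n) {ts : Fin n → Term A M Op K} :
      (∀ i, Guarded (ts i)) → Guarded (op o ts)

/-- The right-nested probabilistic choice of `t 0, …, t n` with weights `w 0, …, w n`. -/
def prc : {n : ℕ} → (w : Fin (n + 1) → M) → SubProb w → (Fin (n + 1) → Term A M Op K) →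
    Term A M Op K
  | 0, _, _, t => t 0
  | _ + 1, w, hw, t =>
      pch (w 0) (hw.1 0) (t 0)
        (prc (fun i => w i.succ * (1 - w 0)⁻¹) hw.tail (fun i => t i.succ))

end

end Term

open Term

/-! ### Conditional equational theories and derivability -/

section

variable {A M K : Type*} [SignedCancellationMeadow M] {Op : ℕ → Type*}

/-- A conditional equational theory, given by the substitution instances of its axioms: `Th Γ l r`
says that `(⋀ (p = q) ∈ Γ) ⇒ l = r` is an instance of an axiom. -/
abbrev Theory (T : Type*) : Type _ := Set (T × T) → T → T → Prop

/-- Derivability of equations in (infinitary) conditional equational logic. -/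
inductive Derives (Th : Theory (Term A M Op K)) : Term A M Op K → Term A M Op K → Prop
  | ax {Γ : Set (Term A M Op K × Term A M Op K)} {l r : Term A M Op K} :
      Th Γ l r → (∀ p ∈ Γ, Derives Th p.1 p.2) → Derives Th l r
  | refl (t : Term A M Op K) : Derives Th t t
  | symm {t u : Term A M Op K} : Derives Th t u → Derives Th u t
  | trans {t u v : Term A M Op K} : Derives Th t u → Derives Th u v → Derives Th t v
  | bin (b : BinOp M) {t t' u u' : Term A M Op K} :
      Derives Th t t' → Derives Th u u' → Derives Th (bin b t u) (bin b t' u')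
  | encap (H : Set A) {t t' : Term A M Op K} :
      Derives Th t t' → Derives Th (encap H t) (encap H t')
  | op {n : ℕ} (o : Op n) {ts ts' : Fin n → Term A M Op K} :
      (∀ i, Derives Th (ts i) (ts' i)) → Derives Th (op o ts) (op o ts')

/-- A communication function; `none` stands for inaction. -/
structure CommFun (A : Type*) where
  γ : Option A → Option A → Option A
  comm : ∀ a b, γ a b = γ b a
  assoc : ∀ a b c, γ (γ a b) c = γ a (γ b c)
  dead : ∀ a, γ none a = none

/-- The axioms of pACP. -/
inductive AxPACP (c : CommFun A) : Theory (Term A M Op K)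
  | A1 (x y) : AxPACP c ∅ (alt x y) (alt y x)
  | A2 (x y z) : AxPACP c ∅ (alt (alt x y) z) (alt x (alt y z))
  | A3 (a : Option A) : AxPACP c ∅ (alt (cst a) (cst a)) (cst a)
  | A4 (x y z) : AxPACP c ∅ (seq (alt x y) z) (alt (seq x z) (seq y z))
  | A5 (x y z) : AxPACP c ∅ (seq (seq x y) z) (seq x (seq y z))
  | A6 (x) : AxPACP c ∅ (alt x dead) x
  | A7 (x) : AxPACP c ∅ (seq dead x) dead
  | D1 (H : Set A) (a : Option A) (ha : ∀ b ∈ H, a ≠ some b) :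
      AxPACP c ∅ (encap H (cst a)) (cst a)
  | D2 (H : Set A) (a : A) (ha : a ∈ H) : AxPACP c ∅ (encap H (act a)) dead
  | D3 (H : Set A) (x y) : AxPACP c ∅ (encap H (alt x y)) (alt (encap H x) (encap H y))
  | D4 (H : Set A) (x y) : AxPACP c ∅ (encap H (seq x y)) (seq (encap H x) (encap H y))
  | pA1 (π : M) (h : IsProb π) (x y) : AxPACP c ∅ (pch π h x y) (pch (1 - π) h.compl y x)
  | pA2 (π ρ : M) (h : IsProb π) (h' : IsProb ρ) (x y z) :
      AxPACP c ∅ (pch ρ h' (pch π h x y) z)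
        (pch (π * ρ) (h.mul h') x
          (pch (((1 - π) * ρ) * (1 - π * ρ)⁻¹) (h.assoc h') y z))
  | pA3 (π : M) (h : IsProb π) (x) : AxPACP c ∅ (pch π h x x) x
  | pA4 (π : M) (h : IsProb π) (x y z) :
      AxPACP c ∅ (seq (pch π h x y) z) (pch π h (seq x z) (seq y z))
  | pA5 (π : M) (h : IsProb π) (x y z) :
      AxPACP c ∅ (alt (pch π h x y) z) (pch π h (alt x z) (alt y z))
  | pA6 (x y) : AxPACP c ∅ (pch 1 isProb_one x y) x
  | CM1 (x y) : AxPACP c {(x, alt x x), (y, alt y y)} (par x y)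
      (alt (alt (leftm x y) (leftm y x)) (commm x y))
  | CM2 (a : Option A) (x) : AxPACP c ∅ (leftm (cst a) x) (seq (cst a) x)
  | CM3 (a : Option A) (x y) : AxPACP c ∅ (leftm (seq (cst a) x) y) (seq (cst a) (par x y))
  | CM4 (x y z) : AxPACP c ∅ (leftm (alt x y) z) (alt (leftm x z) (leftm y z))
  | CM5 (a b : Option A) (x) :
      AxPACP c ∅ (commm (seq (cst a) x) (cst b)) (seq (cst (c.γ a b)) x)
  | CM6 (a b : Option A) (x) :
      AxPACP c ∅ (commm (cst a) (seq (cst b) x)) (seq (cst (c.γ a b)) x)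
  | CM7 (a b : Option A) (x y) :
      AxPACP c ∅ (commm (seq (cst a) x) (seq (cst b) y)) (seq (cst (c.γ a b)) (par x y))
  | CM8 (x y z) : AxPACP c ∅ (commm (alt x y) z) (alt (commm x z) (commm y z))
  | CM9 (x y z) : AxPACP c ∅ (commm x (alt y z)) (alt (commm x y) (commm x z))
  | CM10 (x) : AxPACP c ∅ (commm dead x) dead
  | CM11 (x) : AxPACP c ∅ (commm x dead) dead
  | CM12 (a b : Option A) : AxPACP c ∅ (commm (cst a) (cst b)) (cst (c.γ a b))
  | pCM1 (π : M) (h : IsProb π) (x y z) :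
      AxPACP c ∅ (par (pch π h x y) z) (pch π h (par x z) (par y z))
  | pCM2 (π : M) (h : IsProb π) (x y z) :
      AxPACP c ∅ (par x (pch π h y z)) (pch π h (par x y) (par x z))
  | pCM3 (π : M) (h : IsProb π) (x y z) :
      AxPACP c ∅ (leftm (pch π h x y) z) (pch π h (leftm x z) (leftm y z))
  | pCM4 (π : M) (h : IsProb π) (x y z) :
      AxPACP c ∅ (leftm x (pch π h y z)) (pch π h (leftm x y) (leftm x z))
  | pCM5 (π : M) (h : IsProb π) (x y z) :
      AxPACP c ∅ (commm (pch π h x y) z) (pch π h (commm x z) (commm y z))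
  | pCM6 (π : M) (h : IsProb π) (x y z) :
      AxPACP c ∅ (commm x (pch π h y z)) (pch π h (commm x y) (commm x z))
  | pD (H : Set A) (π : M) (h : IsProb π) (x y) :
      AxPACP c ∅ (encap H (pch π h x y)) (pch π h (encap H x) (encap H y))

/-! ### Guarded recursive specifications -/

/-- A recursive specification: a set of recursion equations `X = rhs X`, one for each variable in
`vars`, whose right-hand sides contain only variables from `vars`. -/
structure RecSpec (A : Type*) (M : Type*) [SignedCancellationMeadow M] (Op : ℕ → Type*) where
  vars : Set Var
  rhs : vars → Term A M Op Empty
  closed : ∀ X, (rhs X).vars ⊆ vars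

/-- `t` is rewritable to `u` using the axioms of `Th` in either direction and the equations of `E`
other than the one for `X` from left to right. -/
inductive Rewrites (Th : Theory (Term A M Op Empty)) (E : RecSpec A M Op) (X : Var) :
    Term A M Op Empty → Term A M Op Empty → Prop
  | ax {t u : Term A M Op Empty} : Derives Th t u → Rewrites Th E X t u
  | unfold (Y : E.vars) (hY : (Y : Var) ≠ X) : Rewrites Th E X (var Y) (E.rhs Y)
  | trans {t u v : Term A M Op Empty} :
      Rewrites Th E X t u → Rewrites Th E X u v → Rewrites Th E X t v
  | bin (b : BinOp M) {t t' u u' : Term A M Op Empty} :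
      Rewrites Th E X t t' → Rewrites Th E X u u' → Rewrites Th E X (bin b t u) (bin b t' u')
  | encap (H : Set A) {t t' : Term A M Op Empty} :
      Rewrites Th E X t t' → Rewrites Th E X (encap H t) (encap H t')
  | op {n : ℕ} (o : Op n) {ts ts' : Fin n → Term A M Op Empty} :
      (∀ i, Rewrites Th E X (ts i) (ts' i)) → Rewrites Th E X (op o ts) (op o ts')

/-- A guarded recursive specification over the process algebra with axioms `Th`. -/
structure GuardedSpec (Th : Theory (Term A M Op Empty)) extends RecSpec A M Op where
  guarded : ∀ X : vars, ∃ u : Term A M Op Empty, Rewrites Th toRecSpec X (rhs X) u ∧ u.Guarded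

/-- The constants `⟨X|E⟩` for guarded recursive specifications `E` and `X ∈ vars(E)`. -/
def RecConst (Th : Theory (Term A M Op Empty)) : Type _ := (E : GuardedSpec Th) × E.vars

/-- The constant `⟨X|E⟩` as a term. -/
def sol {Th : Theory (Term A M Op Empty)} (E : GuardedSpec Th) (X : E.vars) :
    Term A M Op (RecConst Th) :=
  Term.con ⟨E, X⟩

open Classical in
/-- `⟨t|E⟩`: the term `t` with every `X ∈ vars(E)` replaced by `⟨X|E⟩`. -/
noncomputable def solTerm {Th : Theory (Term A M Op Empty)} (E : GuardedSpec Th)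
    (t : Term A M Op Empty) : Term A M Op (RecConst Th) :=
  t.subst (fun Y => if h : Y ∈ E.vars then sol E ⟨Y, h⟩ else var Y)

/-- The axioms for guarded recursion. -/
inductive AxRec (Th : Theory (Term A M Op Empty)) : Theory (Term A M Op (RecConst Th))
  | RDP (E : GuardedSpec Th) (X : E.vars) : AxRec Th ∅ (sol E X) (solTerm E (E.rhs X))
  | RSP (E : GuardedSpec Th) (X : E.vars) (σ : Var → Term A M Op (RecConst Th)) :
      AxRec Th (Set.range fun Y : E.vars => (σ Y, (E.rhs Y).subst σ)) (σ X) (sol E X)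

end

/-! ### Probabilistic strategic interleaving -/

/-- `IsHist n h`: the sequence `h` is an interleaving history for `n` processes (`n ≥ 1`). -/
inductive IsHist : ℕ → List (ℕ × ℕ) → Prop
  | nil {n : ℕ} : 1 ≤ n → IsHist n []
  | snoc {n j m : ℕ} {h : List (ℕ × ℕ)} :
      IsHist n h → 1 ≤ j → j ≤ n → 1 ≤ m → n ≤ m + 1 → m ≤ n + 1 → IsHist m (h ++ [(j, m)])

/-- The set of interleaving histories for `n` processes (empty for `n = 0`). -/
def Hist (n : ℕ) : Type := {h : List (ℕ × ℕ) // IsHist n h}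

/-- The history `h` extended with a turn of the `i`th process, after which there are `m`
processes; elements of `Fin n` are counted from `0`, processes from `1`. -/
def Hist.step {n : ℕ} (h : Hist n) (i : Fin n) (m : ℕ)
    (hm : 1 ≤ m := by omega) (h1 : n ≤ m + 1 := by omega) (h2 : m ≤ n + 1 := by omega) :
    Hist m :=
  ⟨h.1 ++ [((i : ℕ) + 1, m)], .snoc h.2 (Nat.succ_le_succ (Nat.zero_le _)) i.2 hm h1 h2⟩

/-- The strategic interleaving and positional strategic interleaving operators of arity `n`. -/
inductive SIOp (S : Type*) (n : ℕ)
  | si (h : Hist n) (s : S)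
  | posm (i : Fin n) (h : Hist n) (s : S)

section

variable {A M S D K : Type*} [SignedCancellationMeadow M]

/-- The parameters of pACP+pSI: abstract schedulers (partial functions), control state
transformers, control actions, and process creation. -/
structure Interleaving (A M S D : Type*) [SignedCancellationMeadow M] (c : CommFun A) where
  sched : {n : ℕ} → Hist n → S → Option (Fin n → Prob M)
  sched_sum : ∀ {n : ℕ} (h : Hist n) (s : S) (f : Fin n → Prob M),
    sched h s = some f → ∑ i, (f i).1 = 1
  /-- the last argument is `true` if the action brings the process to successful termination -/
  updat : {n : ℕ} → Hist n → S → Fin n → A → Bool → S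
  /-- the control actions -/
  C : Set A
  updat_of_notMem : ∀ {n : ℕ} (h : Hist n) (s : S) (i : Fin n) (a : A),
    a ∉ C → updat h s i a false = s
  /-- the trace left by a control action -/
  bar : C → A
  bar_notMem : ∀ x : C, bar x ∉ C
  comm_ne_control : ∀ (x : C) (a b : A), c.γ (some a) (some b) ≠ some (x : A)
  comm_ne_bar : ∀ (x : C) (a b : A), c.γ (some a) (some b) ≠ some (bar x)
  comm_control : ∀ (x : C) (a : A), c.γ (some a) (some (x : A)) = none
  comm_bar : ∀ (x : C) (a : A), c.γ (some a) (some (bar x)) = none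
  /-- process creation requests -/
  cr : D → A
  /-- process creation acts -/
  rcr : D → A
  /-- the process to be created, a closed term -/
  crea : D → Term A M (SIOp S) Empty
  crea_closed : ∀ d, (crea d).vars = ∅
  comm_cr : ∀ (d : D) (a : A), c.γ (some (cr d)) (some a) = none
  comm_ne_cr : ∀ (d : D) (a b : A), c.γ (some a) (some b) ≠ some (cr d)

abbrev si {n : ℕ} (h : Hist n) (s : S) (x : Fin n → Term A M (SIOp S) K) :
    Term A M (SIOp S) K :=
  Term.op (SIOp.si h s) x

abbrev posm {n : ℕ} (i : Fin n) (h : Hist n) (s : S) (x : Fin n → Term A M (SIOp S) K) :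
    Term A M (SIOp S) K :=
  Term.op (SIOp.posm i h s) x

variable {c : CommFun A}

theorem Interleaving.subProb (I : Interleaving A M S D c) {n : ℕ} {h : Hist n} {s : S}
    {f : Fin n → Prob M} (hf : I.sched h s = some f) : SubProb (fun i => (f i).1) :=
  ⟨fun i => (f i).2, by rw [I.sched_sum h s f hf]; exact isProb_one⟩

/-- The additional axioms of pACP+pSI. -/
inductive AxSI (I : Interleaving A M S D c) : Theory (Term A M (SIOp S) K)
  | SI0 {n : ℕ} (h : Hist (n + 1)) (s : S) (x : Fin (n + 1) → Term A M (SIOp S) K)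
      (hf : I.sched h s = none) :
      AxSI I (Set.range fun i => (x i, alt (x i) (x i))) (si h s x) dead
  | SI1 {n : ℕ} (h : Hist (n + 1)) (s : S) (x : Fin (n + 1) → Term A M (SIOp S) K)
      (f : Fin (n + 1) → Prob M) (hf : I.sched h s = some f) :
      AxSI I (Set.range fun i => (x i, alt (x i) (x i))) (si h s x)
        (prc (fun i => (f i).1) (I.subProb hf) (fun i => posm i h s x))
  | SI2 {n : ℕ} (i : Fin n) (h : Hist n) (s : S) (x : Fin n → Term A M (SIOp S) K) :
      AxSI I ∅ (posm i h s (Function.update x i dead)) dead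
  | SI3 (h : Hist 1) (s : S) (a : A) (ha : ∀ d, a ≠ I.cr d) :
      AxSI I ∅ (posm 0 h s (fun _ => act a)) (act a)
  | SI4 {n : ℕ} (i : Fin (n + 2)) (h : Hist (n + 2)) (s : S)
      (x : Fin (n + 2) → Term A M (SIOp S) K) (a : A) (ha : ∀ d, a ≠ I.cr d) :
      AxSI I ∅ (posm i h s (Function.update x i (act a)))
        (seq (act a) (si (h.step i (n + 1)) (I.updat h s i a true) (i.removeNth x)))
  | SI5 {n : ℕ} (i : Fin (n + 1)) (h : Hist (n + 1)) (s : S)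
      (x : Fin (n + 1) → Term A M (SIOp S) K) (a : A) (ha : ∀ d, a ≠ I.cr d)
      (y : Term A M (SIOp S) K) :
      AxSI I ∅ (posm i h s (Function.update x i (seq (act a) y)))
        (seq (act a) (si (h.step i (n + 1)) (I.updat h s i a false) (Function.update x i y)))
  | SI6 {n : ℕ} (i : Fin (n + 1)) (h : Hist (n + 1)) (s : S)
      (x : Fin (n + 1) → Term A M (SIOp S) K) (d : D) :
      AxSI I ∅ (posm i h s (Function.update x i (act (I.cr d))))
        (seq (act (I.rcr d)) (si (h.step i (n + 1)) (I.updat h s i (I.cr d) true)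
          (Fin.snoc (α := fun _ => Term A M (SIOp S) K) (i.removeNth x)
            ((I.crea d).subst var))))
  | SI7 {n : ℕ} (i : Fin (n + 1)) (h : Hist (n + 1)) (s : S)
      (x : Fin (n + 1) → Term A M (SIOp S) K) (d : D) (y : Term A M (SIOp S) K) :
      AxSI I ∅ (posm i h s (Function.update x i (seq (act (I.cr d)) y)))
        (seq (act (I.rcr d)) (si (h.step i (n + 2)) (I.updat h s i (I.cr d) false)
          (Fin.snoc (α := fun _ => Term A M (SIOp S) K) (Function.update x i y)
            ((I.crea d).subst var))))
  | SI8 {n : ℕ} (i : Fin n) (h : Hist n) (s : S) (x : Fin n → Term A M (SIOp S) K)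
      (y z : Term A M (SIOp S) K) :
      AxSI I ∅ (posm i h s (Function.update x i (alt y z)))
        (alt (posm i h s (Function.update x i y)) (posm i h s (Function.update x i z)))
  | pSI1 {n : ℕ} (i : Fin n) (h : Hist n) (s : S) (x : Fin n → Term A M (SIOp S) K)
      (π : M) (hπ : IsProb π) (y z : Term A M (SIOp S) K) :
      AxSI I ∅ (si h s (Function.update x i (pch π hπ y z)))
        (pch π hπ (si h s (Function.update x i y)) (si h s (Function.update x i z)))
  | pSI2 {n : ℕ} (i : Fin n) (h : Hist n) (s : S) (x : Fin n → Term A M (SIOp S) K)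
      (π : M) (hπ : IsProb π) (y z : Term A M (SIOp S) K) :
      AxSI I ∅ (posm i h s (Function.update x i (pch π hπ y z)))
        (pch π hπ (posm i h s (Function.update x i y)) (posm i h s (Function.update x i z)))

/-! ### The three process algebras -/

/-- pACP. -/
def pACP (M : Type*) [SignedCancellationMeadow M] (c : CommFun A) :
    Theory (Term A M NoOp Empty) :=
  AxPACP c

/-- The axioms of pACP+pSI, over terms that may contain further constants from `K`. -/
def pACPpSIWith (K : Type*) (I : Interleaving A M S D c) : Theory (Term A M (SIOp S) K) :=
  fun Γ l r => AxPACP c Γ l r ∨ AxSI I Γ l r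

/-- pACP+pSI. -/
def pACPpSI (I : Interleaving A M S D c) : Theory (Term A M (SIOp S) Empty) :=
  pACPpSIWith Empty I

/-- pACP+pSI with guarded recursion. -/
def pACPpSIrec (I : Interleaving A M S D c) :
    Theory (Term A M (SIOp S) (RecConst (pACPpSI I))) :=
  fun Γ l r => pACPpSIWith (RecConst (pACPpSI I)) I Γ l r ∨ AxRec (pACPpSI I) Γ l r

/-! ### Guarded recursive specifications over pACP are such specifications over pACP+pSI -/

theorem vars_embed {Op : ℕ → Type*} (t : Term A M NoOp Empty) :
    (t.embed : Term A M Op K).vars = t.vars := by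
  induction t with
  | var x => rfl
  | con k => exact k.elim
  | cst a => rfl
  | bin b t u iht ihu => simp [embed, Term.vars, iht, ihu]
  | encap H t ih => simp [embed, Term.vars, ih]
  | op o ts ih => exact o.elim

theorem guarded_embed {Op : ℕ → Type*} {t : Term A M NoOp Empty} (ht : t.Guarded) :
    (t.embed : Term A M Op K).Guarded := by
  induction ht with
  | con k => exact k.elim
  | cst a => exact .cst a
  | pre a t => exact .pre a _
  | bin b _ _ iht ihu => exact .bin b iht ihu
  | encap H _ ih => exact .encap H ih
  | op o _ _ => exact o.elim

theorem axPACP_embed {Op : ℕ → Type*}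
    {Γ : Set (Term A M NoOp Empty × Term A M NoOp Empty)} {l r : Term A M NoOp Empty}
    (h : AxPACP c Γ l r) :
    AxPACP c ((fun p => (p.1.embed, p.2.embed)) '' Γ)
      (l.embed : Term A M Op K) (r.embed : Term A M Op K) := by
  cases h <;> simp only [Set.image_empty, Set.image_pair, embed] <;> constructor <;> assumption

theorem derives_embed (I : Interleaving A M S D c) {t u : Term A M NoOp Empty}
    (h : Derives (pACP M c) t u) : Derives (pACPpSI I) t.embed u.embed := by
  induction h with
  | ax hax _ ih =>
    refine .ax (Or.inl (axPACP_embed hax)) ?_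
    rintro _ ⟨p, hp, rfl⟩
    exact ih p hp
  | refl t => exact .refl _
  | symm _ ih => exact .symm ih
  | trans _ _ ih1 ih2 => exact .trans ih1 ih2
  | bin b _ _ ih1 ih2 => exact .bin b ih1 ih2
  | encap H _ ih => exact .encap H ih
  | op o _ _ => exact o.elim

/-- A recursive specification over pACP as one over pACP+pSI. -/
def RecSpec.embed (E : RecSpec A M NoOp) : RecSpec A M (SIOp S) where
  vars := E.vars
  rhs X := (E.rhs X).embed
  closed X := by rw [vars_embed]; exact E.closed X

theorem rewrites_embed (I : Interleaving A M S D c) {E : RecSpec A M NoOp} {X : Var}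
    {t u : Term A M NoOp Empty} (h : Rewrites (pACP M c) E X t u) :
    Rewrites (pACPpSI I) E.embed X t.embed u.embed := by
  induction h with
  | ax h => exact .ax (derives_embed I h)
  | unfold Y hY => exact Rewrites.unfold (E := E.embed) Y hY
  | trans _ _ ih1 ih2 => exact .trans ih1 ih2
  | bin b _ _ ih1 ih2 => exact .bin b ih1 ih2
  | encap H _ ih => exact .encap H ih
  | op o _ _ => exact o.elim

/-- A guarded recursive specification over pACP as one over pACP+pSI. -/
def GuardedSpec.embed (I : Interleaving A M S D c) (E : GuardedSpec (pACP M c)) :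
    GuardedSpec (pACPpSI I) where
  toRecSpec := E.toRecSpec.embed
  guarded X := by
    obtain ⟨u, hu, hg⟩ := E.guarded X
    exact ⟨u.embed, rewrites_embed I hu, guarded_embed hg⟩

end

end ProcAlg

namespace ProcAlg

open SignedCancellationMeadow Term

section

variable {A M K : Type*} [SignedCancellationMeadow M] {Op : ℕ → Type*} {c : CommFun A}

/-! ### Substitution -/

/-! Strategic interleaving adds no expressive power because it can be eliminated one step at a time.
Every closed term of pACP+pSI with guarded recursion is derivably equal to a head normal form: a
probabilistic choice between finite sums of constants and terms `a · t` with `t` closed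
(`hasHNF_of_closed`). The operators permitted at the top of a head normal form are those of pACP;
interleaving operators and recursion constants survive only inside the derivatives `t`.

For the operators, this is closure of head normal forms under each of them (`HasHNF.bin`,
`HasHNF.encap`, `HasHNF.op`). The axioms expanding `∥` and `si` carry premises `x = x + x`, so
probabilistic choices have to be moved outwards before they apply; the remaining operands are sums,
which satisfy the premise (`IsSum.derives_alt_self`). For a constant `⟨X|E⟩`, RDP and guardedness
give a guarded term, and guardedness keeps the recursion variables out of the first step
(`Guarded.hasHNF_subst`, `hasHNF_sol`).

Derivatives are closed again, so the process can be iterated. A head normal form has finitely many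
derivatives, hence the terms reached from `⟨X|E⟩` are countably many and can be indexed by the
variables (`exists_seq_isHNF`). Replacing each derivative by the variable indexing it turns the head
normal forms into guarded pACP terms, the right-hand sides of `E'` (`IsHNF.exists_embed`). The
reached terms solve `E'`, so RSP identifies the first of them with `⟨X|E'⟩`. -/

theorem subst_congr {t : Term A M Op Empty} {σ τ : Var → Term A M Op K}
    (h : ∀ Y ∈ t.vars, σ Y = τ Y) : t.subst σ = t.subst τ := by
  induction t with
  | var x => exact h x rfl
  | con k => exact k.elim
  | cst a => rfl
  | bin b t u iht ihu =>
    simp only [Term.subst]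
    rw [iht fun Y hY => h Y (Or.inl hY), ihu fun Y hY => h Y (Or.inr hY)]
  | encap H t ih => simp only [Term.subst]; rw [ih h]
  | op o ts ih =>
    simp only [Term.subst]
    congr 1
    funext i
    exact ih i fun Y hY => h Y (Set.mem_iUnion.mpr ⟨i, hY⟩)

theorem subst_subst (t : Term A M Op Empty) (τ : Var → Term A M Op Empty)
    (σ : Var → Term A M Op K) :
    (t.subst τ).subst σ = t.subst fun Y => (τ Y).subst σ := by
  induction t with
  | var x => rfl
  | con k => exact k.elim
  | cst a => rfl
  | bin b t u iht ihu => simp [Term.subst, iht, ihu]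
  | encap H t ih => simp [Term.subst, ih]
  | op o ts ih => simp [Term.subst, ih]

theorem vars_subst_eq_empty {σ : Var → Term A M Op K} (hσ : ∀ Y, (σ Y).vars = ∅)
    (t : Term A M Op Empty) : (t.subst σ).vars = ∅ := by
  induction t with
  | var x => exact hσ x
  | con k => exact k.elim
  | cst a => rfl
  | bin b t u iht ihu => simp [Term.subst, Term.vars, iht, ihu]
  | encap H t ih => simp [Term.subst, Term.vars, ih]
  | op o ts ih => simp [Term.subst, Term.vars, ih]

theorem vars_subst_of_closed {t : Term A M Op Empty} (ht : t.vars = ∅)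
    (σ : Var → Term A M Op K) : (t.subst σ).vars = ∅ := by
  -- No variable occurs in `t`, so `σ` may be exchanged for any substitution by closed terms.
  rw [subst_congr (τ := fun _ => dead) (by simp [ht])]
  exact vars_subst_eq_empty (fun _ => rfl) t

theorem axPACP_subst (σ : Var → Term A M Op K)
    {Γ : Set (Term A M Op Empty × Term A M Op Empty)} {l r : Term A M Op Empty}
    (h : AxPACP c Γ l r) :
    AxPACP c ((fun p => (p.1.subst σ, p.2.subst σ)) '' Γ) (l.subst σ) (r.subst σ) := by
  cases h <;> simp only [Set.image_empty, Set.image_pair, Term.subst] <;> constructor <;> assumption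

theorem prc_subst (σ : Var → Term A M Op K) {n : ℕ} (w : Fin (n + 1) → M) (hw : SubProb w)
    (t : Fin (n + 1) → Term A M Op Empty) :
    (prc w hw t).subst σ = prc w hw fun i => (t i).subst σ := by
  induction n with
  | zero => rfl
  | succ n ih => simp only [prc, Term.subst, ih]

theorem update_subst (σ : Var → Term A M Op K) {n : ℕ} (x : Fin n → Term A M Op Empty)
    (i : Fin n) (y : Term A M Op Empty) :
    (fun j => (Function.update x i y j).subst σ) =
      Function.update (fun j => (x j).subst σ) i (y.subst σ) := by
  funext j
  by_cases hj : j = i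
  · subst hj; simp
  · simp [hj]

theorem snoc_subst (σ : Var → Term A M Op K) {n : ℕ} (x : Fin n → Term A M Op Empty)
    (y : Term A M Op Empty) :
    (fun j => (Fin.snoc (α := fun _ => Term A M Op Empty) x y j).subst σ) =
      Fin.snoc (α := fun _ => Term A M Op K) (fun j => (x j).subst σ) (y.subst σ) := by
  funext j
  refine Fin.lastCases ?_ (fun j => ?_) j <;> simp

/-! ### Head normal forms -/

/-- Finite sums of constants and of terms `a · t` with `t` in `P`. -/
inductive IsSum (P : Set (Term A M Op K)) : Term A M Op K → Prop
  | cst (a : Option A) : IsSum P (cst a)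
  | pre (a : A) {t : Term A M Op K} : t ∈ P → IsSum P (seq (act a) t)
  | alt {t u : Term A M Op K} : IsSum P t → IsSum P u → IsSum P (alt t u)

/-- Head normal forms: probabilistic choices between sums, with derivatives in `P`. -/
inductive IsHNF (P : Set (Term A M Op K)) : Term A M Op K → Prop
  | sum {t : Term A M Op K} : IsSum P t → IsHNF P t
  | pch (π : M) (h : IsProb π) {t u : Term A M Op K} :
      IsHNF P t → IsHNF P u → IsHNF P (pch π h t u)

/-- `t` is derivably equal to a head normal form whose derivatives are closed. -/
def HasHNF (Th : Theory (Term A M Op K)) (t : Term A M Op K) : Prop :=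
  ∃ u, Derives Th t u ∧ IsHNF {v | v.vars = ∅} u

/-- The list collects the finitely many derivatives of `t`. It allows the set of all closed terms to
be exchanged for the range of a sequence that contains just these derivatives. -/
theorem IsSum.exists_list {P : Set (Term A M Op K)} {t : Term A M Op K} (h : IsSum P t) :
    ∃ l : List (Term A M Op K), (∀ u ∈ l, u ∈ P) ∧ ∀ Q, (∀ u ∈ l, u ∈ Q) → IsSum Q t := by
  induction h with
  | cst a => exact ⟨[], by simp, fun Q _ => .cst a⟩
  | @pre a t ht => exact ⟨[t], by simpa using ht, fun Q hQ => .pre a (hQ t (by simp))⟩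
  | alt _ _ ih1 ih2 =>
    obtain ⟨l1, h1, h1'⟩ := ih1
    obtain ⟨l2, h2, h2'⟩ := ih2
    refine ⟨l1 ++ l2, fun u hu => ?_, fun Q hQ => .alt (h1' Q fun u hu => hQ u ?_)
      (h2' Q fun u hu => hQ u ?_)⟩
    · exact (List.mem_append.mp hu).elim (h1 u) (h2 u)
    · exact List.mem_append_left _ hu
    · exact List.mem_append_right _ hu

theorem IsHNF.exists_list {P : Set (Term A M Op K)} {t : Term A M Op K} (h : IsHNF P t) :
    ∃ l : List (Term A M Op K), (∀ u ∈ l, u ∈ P) ∧ ∀ Q, (∀ u ∈ l, u ∈ Q) → IsHNF Q t := by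
  induction h with
  | sum h =>
    obtain ⟨l, h1, h2⟩ := h.exists_list
    exact ⟨l, h1, fun Q hQ => .sum (h2 Q hQ)⟩
  | pch π hπ _ _ ih1 ih2 =>
    obtain ⟨l1, h1, h1'⟩ := ih1
    obtain ⟨l2, h2, h2'⟩ := ih2
    refine ⟨l1 ++ l2, fun u hu => ?_, fun Q hQ => .pch π hπ (h1' Q fun u hu => hQ u ?_)
      (h2' Q fun u hu => hQ u ?_)⟩
    · exact (List.mem_append.mp hu).elim (h1 u) (h2 u)
    · exact List.mem_append_left _ hu
    · exact List.mem_append_right _ hu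

/-- A derivative `σ n` is replaced by the variable `n`. Each such variable stands directly behind an
action, whence guardedness. -/
theorem IsSum.exists_embed {σ : Var → Term A M Op K} {t : Term A M Op K}
    (h : IsSum (Set.range σ) t) :
    ∃ v : Term A M NoOp Empty, v.Guarded ∧ (v.embed : Term A M Op Empty).subst σ = t := by
  induction h with
  | cst a => exact ⟨Term.cst a, .cst a, rfl⟩
  | pre a ht =>
    obtain ⟨n, rfl⟩ := ht
    exact ⟨seq (act a) (var n), .pre a _, rfl⟩
  | alt _ _ ih1 ih2 =>
    obtain ⟨v1, h1, rfl⟩ := ih1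
    obtain ⟨v2, h2, rfl⟩ := ih2
    exact ⟨Term.alt v1 v2, .bin _ h1 h2, rfl⟩

theorem IsHNF.exists_embed {σ : Var → Term A M Op K} {t : Term A M Op K}
    (h : IsHNF (Set.range σ) t) :
    ∃ v : Term A M NoOp Empty, v.Guarded ∧ (v.embed : Term A M Op Empty).subst σ = t := by
  induction h with
  | sum h => exact h.exists_embed
  | pch π hπ _ _ ih1 ih2 =>
    obtain ⟨v1, h1, rfl⟩ := ih1
    obtain ⟨v2, h2, rfl⟩ := ih2
    exact ⟨Term.pch π hπ v1 v2, .bin _ h1 h2, rfl⟩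

variable {Th : Theory (Term A M Op K)}

theorem Derives.of_ax {l r : Term A M Op K} (h : Th ∅ l r) : Derives Th l r :=
  .ax h fun _ hp => hp.elim

theorem HasHNF.of_derives {t u : Term A M Op K} (h : Derives Th t u) (hu : HasHNF Th u) :
    HasHNF Th t :=
  let ⟨v, h1, h2⟩ := hu
  ⟨v, h.trans h1, h2⟩

theorem IsSum.hasHNF {t : Term A M Op K} (h : IsSum {v | v.vars = ∅} t) : HasHNF Th t :=
  ⟨t, .refl t, .sum h⟩

theorem HasHNF.cst (a : Option A) : HasHNF Th (cst a) :=
  (IsSum.cst a).hasHNF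

theorem HasHNF.pch (π : M) (h : IsProb π) {t u : Term A M Op K} (ht : HasHNF Th t)
    (hu : HasHNF Th u) : HasHNF Th (pch π h t u) :=
  let ⟨_, h1, h2⟩ := ht
  let ⟨_, h3, h4⟩ := hu
  ⟨_, .bin _ h1 h3, .pch π h h2 h4⟩

theorem HasHNF.prc {n : ℕ} (w : Fin (n + 1) → M) (hw : SubProb w)
    {t : Fin (n + 1) → Term A M Op K} (ht : ∀ i, HasHNF Th (t i)) : HasHNF Th (prc w hw t) := by
  induction n with
  | zero => exact ht 0
  | succ n ih => exact .pch _ _ (ht 0) (ih _ _ fun i => ht i.succ)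

/-! ### Closure of head normal forms under the operators of pACP -/

section

variable (hTh : ∀ Γ l r, AxPACP c Γ l r → Th Γ l r)
include hTh

/-- Communication and encapsulation may turn an action prefix into `δ · t`, which is not itself a
summand of a head normal form; A7 reduces it to `δ`. -/
theorem HasHNF.seq_cst (a : Option A) {t : Term A M Op K} (ht : t.vars = ∅) :
    HasHNF Th (seq (Term.cst a) t) := by
  cases a with
  | none => exact .of_derives (.of_ax (hTh _ _ _ (.A7 t))) (.cst none)
  | some a => exact (IsSum.pre a ht).hasHNF

/-- Idempotence of `+` is an axiom for constants only. A4 lifts it to `a · t`, and commutativity and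
associativity lift it to sums. This discharges the premises of CM1, SI0 and SI1. -/
theorem IsSum.derives_alt_self {P : Set (Term A M Op K)} {t : Term A M Op K} (h : IsSum P t) :
    Derives Th t (Term.alt t t) := by
  induction h with
  | cst a => exact .symm (.of_ax (hTh _ _ _ (.A3 a)))
  | @pre a t _ =>
    exact .trans (.bin _ (.symm (.of_ax (hTh _ _ _ (.A3 (some a))))) (.refl t))
      (.of_ax (hTh _ _ _ (.A4 _ _ _)))
  | @alt t u _ _ ih1 ih2 =>
    have comm : ∀ x y : Term A M Op K, Derives Th (Term.alt x y) (Term.alt y x) :=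
      fun x y => .of_ax (hTh _ _ _ (.A1 x y))
    have assoc : ∀ x y z : Term A M Op K,
        Derives Th (Term.alt (Term.alt x y) z) (Term.alt x (Term.alt y z)) :=
      fun x y z => .of_ax (hTh _ _ _ (.A2 x y z))
    -- `(t + t) + (u + u) = t + (t + (u + u)) = t + (u + (t + u)) = (t + u) + (t + u)`; the middle
    -- equation is left to the next line.
    refine .trans (.bin _ ih1 ih2) (.trans (assoc _ _ _) (.trans (.bin _ (.refl t) ?_)
      (.symm (assoc _ _ _))))
    exact .trans (.symm (assoc _ _ _)) (.trans (.bin _ (comm _ _) (.refl u)) (assoc _ _ _))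

theorem HasHNF.alt {t u : Term A M Op K} (ht : HasHNF Th t) (hu : HasHNF Th u) :
    HasHNF Th (alt t u) := by
  obtain ⟨t', h1, ht'⟩ := ht
  obtain ⟨u', h2, hu'⟩ := hu
  refine .of_derives (.bin _ h1 h2) ?_
  clear h1 h2
  induction ht' with
  | pch π h _ _ ih1 ih2 => exact .of_derives (.of_ax (hTh _ _ _ (.pA5 π h _ _ _))) (.pch π h ih1 ih2)
  | sum hs =>
    induction hu' with
    | sum hs' => exact (IsSum.alt hs hs').hasHNF
    | pch π h _ _ ih1 ih2 =>
      -- pA5 distributes `+` over a choice in the left operand only, so a choice on the right is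
      -- reached by commutativity.
      have comm : ∀ x y : Term A M Op K, Derives Th (Term.alt x y) (Term.alt y x) :=
        fun x y => .of_ax (hTh _ _ _ (.A1 x y))
      refine .of_derives (.trans (comm _ _) (.of_ax (hTh _ _ _ (.pA5 π h _ _ _))))
        (.pch π h ?_ ?_)
      · exact .of_derives (comm _ _) ih1
      · exact .of_derives (comm _ _) ih2

/-- The second operand only ever moves behind an action, so it has to be closed but needs no head
normal form. The same holds for the left merge. -/
theorem HasHNF.seq {t u : Term A M Op K} (ht : HasHNF Th t) (hu : u.vars = ∅) :
    HasHNF Th (seq t u) := by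
  obtain ⟨t', h1, ht'⟩ := ht
  refine .of_derives (.bin _ h1 (.refl u)) ?_
  clear h1
  induction ht' with
  | pch π h _ _ ih1 ih2 => exact .of_derives (.of_ax (hTh _ _ _ (.pA4 π h _ _ _))) (.pch π h ih1 ih2)
  | sum hs =>
    induction hs with
    | cst a => exact .seq_cst hTh a hu
    | pre a ht =>
      exact .of_derives (.of_ax (hTh _ _ _ (.A5 _ _ _)))
        (.seq_cst hTh _ (by simpa [Term.vars, hu] using ht))
    | alt _ _ ih1 ih2 => exact .of_derives (.of_ax (hTh _ _ _ (.A4 _ _ _))) (.alt hTh ih1 ih2)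

open Classical in
theorem HasHNF.encap (H : Set A) {t : Term A M Op K} (ht : HasHNF Th t) :
    HasHNF Th (encap H t) := by
  obtain ⟨t', h1, ht'⟩ := ht
  refine .of_derives (.encap H h1) ?_
  clear h1
  have enc : ∀ a : Option A, ∃ b : Option A,
      Derives Th (Term.encap H (Term.cst a)) (Term.cst b) := by
    intro a
    by_cases ha : ∃ b ∈ H, a = some b
    · obtain ⟨b, hb, rfl⟩ := ha
      exact ⟨none, .of_ax (hTh _ _ _ (.D2 H b hb))⟩
    · exact ⟨a, .of_ax (hTh _ _ _ (.D1 H a fun b hb h => ha ⟨b, hb, h⟩))⟩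
  induction ht' with
  | pch π h _ _ ih1 ih2 => exact .of_derives (.of_ax (hTh _ _ _ (.pD H π h _ _))) (.pch π h ih1 ih2)
  | sum hs =>
    induction hs with
    | cst a =>
      obtain ⟨b, hb⟩ := enc a
      exact .of_derives hb (.cst b)
    | pre a ht =>
      obtain ⟨b, hb⟩ := enc (some a)
      exact .of_derives (.trans (.of_ax (hTh _ _ _ (.D4 H _ _))) (.bin _ hb (.refl _)))
        (.seq_cst hTh b ht)
    | alt _ _ ih1 ih2 => exact .of_derives (.of_ax (hTh _ _ _ (.D3 H _ _))) (.alt hTh ih1 ih2)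

theorem HasHNF.leftm {t u : Term A M Op K} (ht : HasHNF Th t) (hu : u.vars = ∅) :
    HasHNF Th (leftm t u) := by
  obtain ⟨t', h1, ht'⟩ := ht
  refine .of_derives (.bin _ h1 (.refl u)) ?_
  clear h1
  induction ht' with
  | pch π h _ _ ih1 ih2 =>
    exact .of_derives (.of_ax (hTh _ _ _ (.pCM3 π h _ _ _))) (.pch π h ih1 ih2)
  | sum hs =>
    induction hs with
    | cst a => exact .of_derives (.of_ax (hTh _ _ _ (.CM2 a u))) (.seq_cst hTh a hu)
    | pre a ht =>
      exact .of_derives (.of_ax (hTh _ _ _ (.CM3 (some a) _ _)))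
        (.seq_cst hTh _ (by simpa [Term.vars, hu] using ht))
    | alt _ _ ih1 ih2 => exact .of_derives (.of_ax (hTh _ _ _ (.CM4 _ _ _))) (.alt hTh ih1 ih2)

/-- With `+` distributed out of both operands, each side is a constant or a prefix, and CM5, CM6,
CM7 and CM12 cover the four combinations. -/
theorem IsSum.hasHNF_commm {t u : Term A M Op K} (ht : IsSum {v | v.vars = ∅} t)
    (hu : IsSum {v | v.vars = ∅} u) : HasHNF Th (commm t u) := by
  induction ht with
  | alt _ _ ih1 ih2 => exact .of_derives (.of_ax (hTh _ _ _ (.CM8 _ _ _))) (.alt hTh ih1 ih2)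
  | cst a =>
    induction hu with
    | cst b => exact .of_derives (.of_ax (hTh _ _ _ (.CM12 _ _))) (.cst _)
    | pre b hu => exact .of_derives (.of_ax (hTh _ _ _ (.CM6 _ _ _))) (.seq_cst hTh _ hu)
    | alt _ _ ih1 ih2 => exact .of_derives (.of_ax (hTh _ _ _ (.CM9 _ _ _))) (.alt hTh ih1 ih2)
  | @pre a t ht =>
    induction hu with
    | cst b => exact .of_derives (.of_ax (hTh _ _ _ (.CM5 _ _ _))) (.seq_cst hTh _ ht)
    | @pre b u hu =>
      refine .of_derives (.of_ax (hTh _ _ _ (.CM7 _ _ _ _))) (.seq_cst hTh _ ?_)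
      exact Set.union_empty_iff.mpr ⟨ht, hu⟩
    | alt _ _ ih1 ih2 => exact .of_derives (.of_ax (hTh _ _ _ (.CM9 _ _ _))) (.alt hTh ih1 ih2)

theorem HasHNF.commm {t u : Term A M Op K} (ht : HasHNF Th t) (hu : HasHNF Th u) :
    HasHNF Th (commm t u) := by
  obtain ⟨t', h1, ht'⟩ := ht
  obtain ⟨u', h2, hu'⟩ := hu
  refine .of_derives (.bin _ h1 h2) ?_
  clear h1 h2
  induction ht' with
  | pch π h _ _ ih1 ih2 =>
    exact .of_derives (.of_ax (hTh _ _ _ (.pCM5 π h _ _ _))) (.pch π h ih1 ih2)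
  | sum hs =>
    induction hu' with
    | sum hs' => exact hs.hasHNF_commm hTh hs'
    | pch π h _ _ ih1 ih2 =>
      exact .of_derives (.of_ax (hTh _ _ _ (.pCM6 π h _ _ _))) (.pch π h ih1 ih2)

omit hTh in
theorem IsSum.vars_eq_empty {t : Term A M Op K} (ht : IsSum {v | v.vars = ∅} t) :
    t.vars = ∅ := by
  induction ht with
  | cst a => rfl
  | pre a ht => exact Set.union_empty_iff.mpr ⟨rfl, ht⟩
  | alt _ _ ih1 ih2 => exact Set.union_empty_iff.mpr ⟨ih1, ih2⟩

theorem HasHNF.par {t u : Term A M Op K} (ht : HasHNF Th t) (hu : HasHNF Th u) :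
    HasHNF Th (par t u) := by
  obtain ⟨t', h1, ht'⟩ := ht
  obtain ⟨u', h2, hu'⟩ := hu
  refine .of_derives (.bin _ h1 h2) ?_
  clear h1 h2
  induction ht' with
  | pch π h _ _ ih1 ih2 =>
    exact .of_derives (.of_ax (hTh _ _ _ (.pCM1 π h _ _ _))) (.pch π h ih1 ih2)
  | @sum t hs =>
    induction hu' with
    | pch π h _ _ ih1 ih2 =>
      exact .of_derives (.of_ax (hTh _ _ _ (.pCM2 π h _ _ _))) (.pch π h ih1 ih2)
    | @sum u hs' =>
      -- Once pCM1 and pCM2 have moved all choices outwards, both operands are sums and the premises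
      -- of CM1 are derivable.
      refine .of_derives (.ax (hTh _ _ _ (.CM1 t u)) ?_)
        (.alt hTh (.alt hTh (.leftm hTh hs.hasHNF hs'.vars_eq_empty)
          (.leftm hTh hs'.hasHNF hs.vars_eq_empty)) (hs.hasHNF_commm hTh hs'))
      rintro p (rfl | rfl)
      · exact hs.derives_alt_self hTh
      · exact hs'.derives_alt_self hTh

theorem HasHNF.bin (b : BinOp M) {t u : Term A M Op K} (ht : HasHNF Th t) (hu : HasHNF Th u)
    (hu' : u.vars = ∅) : HasHNF Th (bin b t u) := by
  cases b with
  | alt => exact .alt hTh ht hu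
  | seq => exact .seq hTh ht hu'
  | pch π => exact .pch π.1 π.2 ht hu
  | par => exact .par hTh ht hu
  | leftm => exact .leftm hTh ht hu'
  | commm => exact .commm hTh ht hu

end

end

/-! ### Head normal forms for strategic interleaving -/

section

variable {A M S D K : Type*} [SignedCancellationMeadow M] {c : CommFun A}
  {I : Interleaving A M S D c}

theorem axSI_subst (σ : Var → Term A M (SIOp S) K)
    {Γ : Set (Term A M (SIOp S) Empty × Term A M (SIOp S) Empty)}
    {l r : Term A M (SIOp S) Empty} (h : AxSI I Γ l r) :
    AxSI I ((fun p => (p.1.subst σ, p.2.subst σ)) '' Γ) (l.subst σ) (r.subst σ) := by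
  -- The process to be created is closed, so SI6 and SI7 are stable under substitution.
  have crea : ∀ d, ((I.crea d).subst var).subst σ = (I.crea d).subst var := fun d => by
    rw [subst_subst]
    exact subst_congr (by simp [I.crea_closed d])
  cases h <;>
    simp only [Set.image_empty, ← Set.range_comp, Function.comp_def, Term.subst, update_subst,
      snoc_subst, prc_subst, crea, Fin.removeNth]
  case SI0 => exact .SI0 _ _ _ ‹_›
  case SI1 => exact .SI1 _ _ _ _ ‹_›
  case SI2 => exact .SI2 _ _ _ _
  case SI3 => exact .SI3 _ _ _ ‹_›
  case SI4 => exact .SI4 _ _ _ _ _ ‹_›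
  case SI5 => exact .SI5 _ _ _ _ _ ‹_› _
  case SI6 => exact .SI6 _ _ _ _ _
  case SI7 => exact .SI7 _ _ _ _ _ _
  case SI8 => exact .SI8 _ _ _ _ _ _
  case pSI1 => exact .pSI1 _ _ _ _ _ _ _ _
  case pSI2 => exact .pSI2 _ _ _ _ _ _ _ _

/-- Guardedness is witnessed by derivations over terms without recursion constants; this carries
them over to terms in which the variables are replaced by such constants. -/
theorem derives_subst {Th : Theory (Term A M (SIOp S) K)}
    (hTh : ∀ Γ l r, pACPpSIWith K I Γ l r → Th Γ l r) (σ : Var → Term A M (SIOp S) K)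
    {t u : Term A M (SIOp S) Empty} (h : Derives (pACPpSI I) t u) :
    Derives Th (t.subst σ) (u.subst σ) := by
  induction h with
  | ax hax _ ih =>
    refine .ax (hTh _ _ _ (hax.imp (axPACP_subst σ) (axSI_subst σ))) ?_
    rintro _ ⟨p, hp, rfl⟩
    exact ih p hp
  | refl t => exact .refl _
  | symm _ ih => exact .symm ih
  | trans _ _ ih1 ih2 => exact .trans ih1 ih2
  | bin b _ _ ih1 ih2 => exact .bin b ih1 ih2
  | encap H _ ih => exact .encap H ih
  | op o _ ih => exact .op o ih

theorem vars_update_eq_empty {Op : ℕ → Type*} {n : ℕ} {x : Fin n → Term A M Op K}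
    (hx : ∀ j, (x j).vars = ∅) (i : Fin n) {y : Term A M Op K} (hy : y.vars = ∅) (j : Fin n) :
    (Function.update x i y j).vars = ∅ := by
  by_cases hj : j = i
  · subst hj; simpa using hy
  · simpa [hj] using hx j

theorem vars_snoc_eq_empty {Op : ℕ → Type*} {n : ℕ} {x : Fin n → Term A M Op K}
    (hx : ∀ j, (x j).vars = ∅) {y : Term A M Op K} (hy : y.vars = ∅) (j : Fin (n + 1)) :
    (Fin.snoc (α := fun _ => Term A M Op K) x y j).vars = ∅ := by
  refine Fin.lastCases ?_ (fun j => ?_) j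
  · simpa using hy
  · simpa using hx j

variable {Th : Theory (Term A M (SIOp S) K)}

section

variable (hTh : ∀ Γ l r, pACPpSIWith K I Γ l r → Th Γ l r)
include hTh

/-- Only the `i`th process takes the first step, so the others need only be closed. The `i`th entry
is written as an update, the form of the axioms, so that it can vary in the induction. -/
theorem HasHNF.posm_update {n : ℕ} (i : Fin n) (h : Hist n) (s : S)
    {x : Fin n → Term A M (SIOp S) K} (hx : ∀ j, (x j).vars = ∅)
    {t : Term A M (SIOp S) K} (ht : IsHNF {v | v.vars = ∅} t) :
    HasHNF Th (posm i h s (Function.update x i t)) := by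
  have hP : ∀ Γ l r, AxPACP c Γ l r → Th Γ l r := fun Γ l r hax => hTh Γ l r (Or.inl hax)
  have hS : ∀ {l r : Term A M (SIOp S) K}, AxSI I ∅ l r → Derives Th l r :=
    fun hax => .of_ax (hTh _ _ _ (Or.inr hax))
  have hsi : ∀ (b : A) {m : ℕ} (h : Hist m) (s : S) {z : Fin m → Term A M (SIOp S) K},
      (∀ j, (z j).vars = ∅) → HasHNF Th (Term.seq (act b) (si h s z)) := fun b m h s z hz =>
    .seq_cst hP _ (Set.iUnion_eq_empty.mpr hz)
  have hcrea : ∀ d, ((I.crea d).subst (var : Var → Term A M (SIOp S) K)).vars = ∅ :=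
    fun d => vars_subst_of_closed (I.crea_closed d) _
  induction ht with
  | pch π hπ _ _ ih1 ih2 => exact .of_derives (hS (.pSI2 i h s x π hπ _ _)) (.pch π hπ ih1 ih2)
  | sum hs =>
    induction hs with
    | alt _ _ ih1 ih2 => exact .of_derives (hS (.SI8 i h s x _ _)) (.alt hP ih1 ih2)
    | cst a =>
      cases a with
      | none => exact .of_derives (hS (.SI2 i h s x)) (.cst none)
      | some a =>
        -- A terminating creation request leaves at least the created process, so SI6 needs no
        -- separate case for a single process; for other actions that case is SI3 and the rest is
        -- SI4.
        by_cases ha : ∃ d, a = I.cr d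
        · obtain ⟨d, rfl⟩ := ha
          cases n with
          | zero => exact i.elim0
          | succ n =>
            exact .of_derives (hS (.SI6 i h s x d))
              (hsi _ _ _ (vars_snoc_eq_empty (fun j => hx _) (hcrea d)))
        · have ha' : ∀ d, a ≠ I.cr d := fun d hd => ha ⟨d, hd⟩
          match n, i, h, x, hx with
          | 0, i, _, _, _ => exact i.elim0
          | 1, i, h, x, _ =>
            obtain rfl : i = 0 := Subsingleton.elim _ _
            have e : Function.update x 0 (act a) = fun _ => act a := by
              funext j
              obtain rfl : j = 0 := Subsingleton.elim _ _
              simp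
            rw [e]
            exact .of_derives (hS (.SI3 h s a ha')) (.cst _)
          | n + 2, i, h, x, hx =>
            exact .of_derives (hS (.SI4 i h s x a ha')) (hsi _ _ _ fun j => hx _)
    | @pre a y hy =>
      cases n with
      | zero => exact i.elim0
      | succ n =>
        by_cases ha : ∃ d, a = I.cr d
        · obtain ⟨d, rfl⟩ := ha
          exact .of_derives (hS (.SI7 i h s x d y))
            (hsi _ _ _ (vars_snoc_eq_empty (vars_update_eq_empty hx i hy) (hcrea d)))
        · exact .of_derives (hS (.SI5 i h s x a (fun d hd => ha ⟨d, hd⟩) y))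
            (hsi _ _ _ (vars_update_eq_empty hx i hy))

theorem HasHNF.posm {n : ℕ} (i : Fin n) (h : Hist n) (s : S)
    {x : Fin n → Term A M (SIOp S) K} (hx : ∀ j, (x j).vars = ∅) (hi : HasHNF Th (x i)) :
    HasHNF Th (posm i h s x) := by
  obtain ⟨t, h1, ht⟩ := hi
  refine .of_derives (.op _ fun j => ?_) (.posm_update hTh i h s hx ht)
  by_cases hj : j = i
  · subst hj; simpa using h1
  · simpa [hj] using Derives.refl (x j)

/-- The scheduler is consulted only here: the entries being sums, the premises of SI0 and SI1 hold,
leaving `δ` or a choice between positional interleavings. -/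
theorem HasHNF.si_of_isSum {n : ℕ} (h : Hist n) (s : S) {x : Fin n → Term A M (SIOp S) K}
    (hx : ∀ i, IsSum {v | v.vars = ∅} (x i)) : HasHNF Th (si h s x) := by
  have hP : ∀ Γ l r, AxPACP c Γ l r → Th Γ l r := fun Γ l r hax => hTh Γ l r (Or.inl hax)
  have hΓ : ∀ p ∈ Set.range fun i => (x i, Term.alt (x i) (x i)), Derives Th p.1 p.2 := by
    rintro _ ⟨i, rfl⟩
    exact (hx i).derives_alt_self hP
  cases n with
  | zero =>
    obtain ⟨l, hl⟩ := h
    -- There are no histories for zero processes.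
    cases hl <;> omega
  | succ n =>
    rcases hf : I.sched h s with _ | f
    · exact .of_derives (.ax (hTh _ _ _ (Or.inr (.SI0 h s x hf))) hΓ) (.cst none)
    · exact .of_derives (.ax (hTh _ _ _ (Or.inr (.SI1 h s x f hf))) hΓ)
        (.prc _ _ fun i => .posm hTh i h s (fun j => (hx j).vars_eq_empty) (hx i).hasHNF)

/-- `J` holds the positions that may still contain probabilistic choices. pSI1 moves them out of one
position at a time, after which the entry there is a sum and the position leaves `J`. -/
theorem HasHNF.si_of_isHNF {n : ℕ} (h : Hist n) (s : S) (J : Finset (Fin n))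
    {x : Fin n → Term A M (SIOp S) K} (hJ : ∀ i ∈ J, IsHNF {v | v.vars = ∅} (x i))
    (hx : ∀ i ∉ J, IsSum {v | v.vars = ∅} (x i)) : HasHNF Th (si h s x) := by
  induction J using Finset.induction_on generalizing x with
  | empty => exact .si_of_isSum hTh h s fun i => hx i (Finset.notMem_empty i)
  | insert k J hk ih =>
    suffices H : ∀ t, IsHNF {v | v.vars = ∅} t → HasHNF Th (si h s (Function.update x k t)) by
      simpa using H (x k) (hJ k (Finset.mem_insert_self k J))
    intro t ht
    induction ht with
    | pch π hπ _ _ ih1 ih2 =>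
      exact .of_derives (.of_ax (hTh _ _ _ (Or.inr (.pSI1 k h s x π hπ _ _)))) (.pch π hπ ih1 ih2)
    | sum hs =>
      refine ih (fun i hi => ?_) fun i hi => ?_
      · have hik : i ≠ k := fun e => hk (e ▸ hi)
        simpa [hik] using hJ i (Finset.mem_insert_of_mem hi)
      · by_cases hik : i = k
        · subst hik; simpa using hs
        · simpa [hik] using hx i (by simp [hik, hi])

theorem HasHNF.si {n : ℕ} (h : Hist n) (s : S) {x : Fin n → Term A M (SIOp S) K}
    (hx : ∀ i, HasHNF Th (x i)) : HasHNF Th (si h s x) := by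
  choose y hy hy' using hx
  exact .of_derives (.op _ hy) (.si_of_isHNF hTh h s Finset.univ (fun i _ => hy' i) (by simp))

theorem HasHNF.op {n : ℕ} (o : SIOp S n) {x : Fin n → Term A M (SIOp S) K}
    (hx : ∀ i, HasHNF Th (x i)) (hx' : ∀ i, (x i).vars = ∅) : HasHNF Th (op o x) := by
  cases o with
  | si h s => exact .si hTh h s hx
  | posm i h s => exact .posm hTh i h s hx' (hx i)

/-- In a guarded term what is substituted for a variable ends up below an action prefix, so `σ`
needs closed values but no head normal forms; this is what breaks the circularity of recursion. -/
theorem Guarded.hasHNF_subst {t : Term A M (SIOp S) Empty} (ht : t.Guarded)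
    {σ : Var → Term A M (SIOp S) K} (hσ : ∀ Y, (σ Y).vars = ∅) : HasHNF Th (t.subst σ) := by
  have hP : ∀ Γ l r, AxPACP c Γ l r → Th Γ l r := fun Γ l r hax => hTh Γ l r (Or.inl hax)
  induction ht with
  | con k => exact k.elim
  | cst a => exact .cst a
  | pre a t => exact .seq_cst hP _ (vars_subst_eq_empty hσ t)
  | bin b _ _ ih1 ih2 => exact .bin hP b ih1 ih2 (vars_subst_eq_empty hσ _)
  | encap H _ ih => exact .encap hP H ih
  | op o _ ih => exact .op hTh o ih fun i => vars_subst_eq_empty hσ _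

end

/-! ### Closed terms of pACP+pSI with guarded recursion -/

/-- Unfolding an equation of `E` becomes an instance of RDP once the variables stand for the
constants. -/
theorem rewrites_subst {E : GuardedSpec (pACPpSI I)} {X : Var}
    {σ : Var → Term A M (SIOp S) (RecConst (pACPpSI I))} (hσ : ∀ Y : E.vars, σ Y = sol E Y)
    {t u : Term A M (SIOp S) Empty} (h : Rewrites (pACPpSI I) E.toRecSpec X t u) :
    Derives (pACPpSIrec I) (t.subst σ) (u.subst σ) := by
  induction h with
  | ax h => exact derives_subst (fun _ _ _ => Or.inl) σ h
  | unfold Y _ =>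
    have e : solTerm E (E.rhs Y) = (E.rhs Y).subst σ := subst_congr fun Z hZ => by
      have hZ' := E.closed Y hZ
      rw [dif_pos hZ', hσ ⟨Z, hZ'⟩]
    have hY : (var (Y : Var) : Term A M (SIOp S) Empty).subst σ = sol E Y := hσ Y
    rw [hY, ← e]
    exact .of_ax (Or.inr (.RDP E Y))
  | trans _ _ ih1 ih2 => exact .trans ih1 ih2
  | bin b _ _ ih1 ih2 => exact .bin b ih1 ih2
  | encap H _ ih => exact .encap H ih
  | op o _ ih => exact .op o ih

open Classical in
theorem hasHNF_sol (E : GuardedSpec (pACPpSI I)) (X : E.vars) :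
    HasHNF (pACPpSIrec I) (sol E X) := by
  let σ : Var → Term A M (SIOp S) (RecConst (pACPpSI I)) :=
    -- The value `δ` outside `vars(E)` makes every value closed. It matters because axioms such as
    -- pA6, read from right to left, may introduce foreign variables into the guarded term.
    fun Y => if h : Y ∈ E.vars then sol E ⟨Y, h⟩ else dead
  have hσ : ∀ Y : E.vars, σ Y = sol E Y := fun Y => dif_pos Y.2
  have hσ' : ∀ Y, (σ Y).vars = ∅ := fun Y => by
    by_cases hY : Y ∈ E.vars
    · rw [hσ ⟨Y, hY⟩]; rfl
    · simp only [σ, dif_neg hY]; rfl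
  have e : solTerm E (E.rhs X) = (E.rhs X).subst σ := subst_congr fun Z hZ => by
    have hZ' := E.closed X hZ
    rw [dif_pos hZ', hσ ⟨Z, hZ'⟩]
  obtain ⟨u, hu, hg⟩ := E.guarded X
  refine .of_derives (.trans (.of_ax (Or.inr (.RDP E X))) ?_)
    (Guarded.hasHNF_subst (Th := pACPpSIrec I) (fun _ _ _ => Or.inl) hg hσ')
  rw [e]
  exact rewrites_subst hσ hu

theorem hasHNF_of_closed {t : Term A M (SIOp S) (RecConst (pACPpSI I))} (ht : t.vars = ∅) :
    HasHNF (pACPpSIrec I) t := by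
  have hP : ∀ Γ l r, AxPACP c Γ l r → pACPpSIrec I Γ l r := fun Γ l r hax => Or.inl (Or.inl hax)
  induction t with
  | var x => exact absurd ht (Set.singleton_ne_empty x)
  | con k => exact hasHNF_sol k.1 k.2
  | cst a => exact .cst a
  | bin b t u iht ihu =>
    obtain ⟨h1, h2⟩ := Set.union_empty_iff.mp ht
    exact .bin hP b (iht h1) (ihu h2) h2
  | encap H t ih => exact .encap hP H (ih ht)
  | op o ts ih =>
    have h := Set.iUnion_eq_empty.mp ht
    exact .op (fun _ _ _ => Or.inl) o (fun i => ih i (h i)) h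

/-- A sequence of closed terms each of which has, up to derivability, a head normal form with
derivatives in the sequence, and which starts at a given closed term and index. -/
theorem exists_seq_isHNF {t : Term A M (SIOp S) (RecConst (pACPpSI I))} (ht : t.vars = ∅)
    (X : Var) :
    ∃ σ : Var → Term A M (SIOp S) (RecConst (pACPpSI I)), σ X = t ∧
      ∀ Y, ∃ u, Derives (pACPpSIrec I) (σ Y) u ∧ IsHNF (Set.range σ) u := by
  have hnf : ∀ t : {t : Term A M (SIOp S) (RecConst (pACPpSI I)) // t.vars = ∅},
      ∃ (u : Term A M (SIOp S) (RecConst (pACPpSI I)))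
        (f : ℕ → {t : Term A M (SIOp S) (RecConst (pACPpSI I)) // t.vars = ∅}),
        Derives (pACPpSIrec I) t.1 u ∧ IsHNF (Set.range fun k => (f k).1) u := by
    intro t
    obtain ⟨u, hu, hn⟩ := hasHNF_of_closed t.2
    obtain ⟨l, hl, hn⟩ := hn.exists_list
    -- The finite list of derivatives is padded with `δ`, so that every natural number names a
    -- closed term.
    refine ⟨u, fun k => ⟨l.getD k dead, ?_⟩, hu, hn _ fun v hv => ?_⟩
    · by_cases hk : k < l.length
      · rw [List.getD_eq_getElem _ _ hk]
        exact hl _ (List.getElem_mem hk)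
      · rw [List.getD_eq_default _ _ (not_lt.mp hk)]
        rfl
    · obtain ⟨k, hk, rfl⟩ := List.mem_iff_getElem.mp hv
      exact ⟨k, List.getD_eq_getElem _ _ hk⟩
  choose u next hu hn using hnf
  -- A word over `ℕ` records which derivative is taken at each step from `t`. The words are numbered
  -- by the variables; the swap gives the empty word, and hence `t` itself, the number `X`.
  let e : Var ≃ List ℕ :=
    (Equiv.swap X (Encodable.encode ([] : List ℕ))).trans (Denumerable.eqv (List ℕ)).symm
  have heX : e X = [] := by
    simp only [e, Equiv.trans_apply, Equiv.swap_apply_left]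
    exact (Denumerable.eqv (List ℕ)).symm_apply_apply []
  refine ⟨fun Y => ((e Y).foldl next ⟨t, ht⟩).1, by simp [heX], fun Y => ⟨_, hu _, ?_⟩⟩
  obtain ⟨l, hl, hn'⟩ := (hn ((e Y).foldl next ⟨t, ht⟩)).exists_list
  refine hn' _ fun v hv => ?_
  obtain ⟨k, rfl⟩ := hl v hv
  -- The `k`th derivative of the term at a word is the term at that word extended by `k`.
  exact ⟨e.symm (e Y ++ [k]), by simp⟩

end

end ProcAlg

/-! ### The expressivity theorem -/

theorem mainTheorem4 {A M S D : Type*} [SignedCancellationMeadow M] (c : ProcAlg.CommFun A)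
    (I : ProcAlg.Interleaving A M S D c)
    (E : ProcAlg.GuardedSpec (ProcAlg.pACPpSI I)) (X : ProcAlg.Var) (hX : X ∈ E.vars) :
    ∃ (E' : ProcAlg.GuardedSpec (ProcAlg.pACP M c)) (hX' : X ∈ E'.vars),
      ProcAlg.Derives (ProcAlg.pACPpSIrec I)
        (ProcAlg.sol E ⟨X, hX⟩) (ProcAlg.sol (E'.embed I) ⟨X, hX'⟩) := by
  obtain ⟨σ, hσX, hσ⟩ := ProcAlg.exists_seq_isHNF (t := ProcAlg.sol E ⟨X, hX⟩) rfl X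
  choose u hu hn using hσ
  choose v hv hvu using fun Y => (hn Y).exists_embed
  let E' : ProcAlg.GuardedSpec (ProcAlg.pACP M c) :=
    { vars := Set.univ
      rhs := fun Y => v Y
      closed := fun _ => Set.subset_univ _
      -- The right-hand sides are guarded as they stand, so no rewriting is needed.
      guarded := fun Y => ⟨v Y, .ax (.refl _), hv Y⟩ }
  refine ⟨E', Set.mem_univ X, ?_⟩
  rw [← hσX]
  -- The sequence `σ` is a solution of `E'`: the premises of RSP are the equations between the terms
  -- `σ Y` and their head normal forms.
  refine .ax (Or.inr (.RSP (E'.embed I) ⟨X, Set.mem_univ X⟩ σ)) ?_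
  rintro _ ⟨Y, rfl⟩
  have h := hu Y
  rw [← hvu] at h
  exact h
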